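/- Let $\tilde G$ be a finite undirected multigraph (parallel edges and self-loops allowed) with edge set $E$ whose vertex set $\tilde V=S\sqcup T\sqcup V$ is partitioned into a set $S$ of inputs, a set $T$ of outputs (each element of $S\sqcup T$, called an open end, has degree one and lies on the edge $e(u)$) and a set $V$ of internal vertices. Let $c:E\to\{1,2,3,\dots\}$ be a capacity function. A tensor assignment $\mathcal T$ gives every $v\in V$ a tensor $\mathcal T_v\in\bigotimes_h\mathbb C^{c_{e(h)}}$, where $h$ runs over the edge ends at $v$ and $e(h)$ is the edge of the end $h$. Contracting along all edges yields a linear map $$\beta(\mathcal T):\bigotimes_{u\in S}\mathbb C^{c_{e(u)}}\to\bigotimes_{u\in T}\mathbb C^{c_{e(u)}},\qquad \langle J|\beta(\mathcal T)|I\rangle=\sum_{W}\prod_{v\in V}\langle W|_v\,|\,\mathcal T_v\rangle,$$ where $W$ runs over all assignments of an index in $\{1,\dots,c_e\}$ to every edge $e$ that agree with $I$ on the inputs and with $J$ on the outputs, and $W|_v$ is the part of $W$ read off at the edge ends at $v$. The quantum max-flow $\mathrm{QMF}(G,c)$ is the maximal rank of $\beta(\mathcal T)$ over all tensor assignments. An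 edge cut set is the set of all edges between $\bar S$ and $\bar T$ for a partition $\tilde V=\bar S\sqcup\bar T$ with $S\subset\bar S$, $T\subset\bar T$; the quantum min-cut $\mathrm{QMC}(G,c)$ is the minimum of $\prod_{e\in C}c_e$ over all edge cut sets $C$. Let $d>0$, $d\neq1$, be a real number such that $c'_e:=\log_d c_e\ge 0$ for every $e\in E$ (automatic if $d>1$). Direct every edge of the graph so that no edge arrives at an input and no edge starts at an output, and let $G'$ be the resulting directed classical network with capacities $c'$. A flow is a function $f:E\to[0,\infty)$ with $f\le c'$ for which inflow equals outflow at every $v\in V$; its value is the total flow on the edges that start in $S$; a max flow is a flow of largest value. The classical min-cut $\mathrm{MC}(G',c')$ is the minimum, over all partitions $\tilde V=\bar S\sqcup\bar T$ as above, of the sum of $c'_e$ over the edges $e$ that start in $\bar S$ and arrive in $\bar T$. Suppose that $\mathrm{MC}(G',c')=\log_d\mathrm{QMC}(G,c)$, and that $G'$ has a max flow $f$ such that for every edge $e$ the number $f_e$ is $\log_d$ of a positive integer, and such that no directed loop of $G'$ has non-zero flow on each of its edges. Then $$\mathrm{QMF}(G,c)=\mathrm{QMC}(G,c).$$ -/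

import Mathlib

/-- A finite undirected multigraph with open ends (parallel edges and self-loops are allowed).
`S` is the set of inputs, `T` the set of outputs, `V` the set of (internal) vertices, `E` the set
of edges.  Every edge `e` has two ends `(e, false)` and `(e, true)`; the two labels only tell the
ends apart and do not direct the edge.  `att` says where an end is attached.  Every input and every
output is attached to exactly one end of an edge (it has degree one). -/
structure OpenGraph (S T V E : Type*) where
  att : E × Bool → S ⊕ T ⊕ V
  inEnd : S → E × Bool
  outEnd : T → E × Bool
  att_eq_in : ∀ (h : E × Bool) (s : S), att h = Sum.inl s ↔ h = inEnd s
  att_eq_out : ∀ (h : E × Bool) (t : T), att h = Sum.inr (Sum.inl t) ↔ h = outEnd t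

namespace OpenGraph

variable {S T V E : Type*} (G : OpenGraph S T V E)

/-- The edge carrying the input `s`. -/
def inEdge (s : S) : E := (G.inEnd s).1

/-- The edge carrying the output `t`. -/
def outEdge (t : T) : E := (G.outEnd t).1

/-- The edge ends incident to the vertex `v` (a self-loop at `v` contributes both its ends). -/
def EndsAt (v : V) : Type _ := {h : E × Bool // G.att h = Sum.inr (Sum.inr v)}

/-! ### The tensor network and the quantum max-flow -/

/-- Tensor assignments.  The tensor at `v` lies in the tensor product of the spaces `ℂ ^ (c e)`, one
factor for each edge end at `v`, and is given by its coordinates in the standard basis. -/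
def TensorAssignment (c : E → ℕ) : Type _ :=
  (v : V) → ((h : G.EndsAt v) → Fin (c h.1.1)) → ℂ

/-- The matrix, in the standard bases of `V_S = ⨂ s, ℂ ^ (c (inEdge s))` and
`V_T = ⨂ t, ℂ ^ (c (outEdge t))`, of the linear map `V_S → V_T` given by the network: the entry at
`(J, I)` is the sum, over all index assignments `W` to the edges that extend `I` and `J`, of the
product of the tensor entries read off at the vertices. -/
noncomputable def beta [Fintype S] [Fintype T] [Fintype V] [Fintype E] [DecidableEq E]
    (c : E → ℕ) (τ : G.TensorAssignment c) :
    Matrix ((t : T) → Fin (c (G.outEdge t))) ((s : S) → Fin (c (G.inEdge s))) ℂ :=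
  fun J I =>
    ∑ W : ((e : E) → Fin (c e)),
      if (∀ s, W (G.inEdge s) = I s) ∧ (∀ t, W (G.outEdge t) = J t) then
        ∏ v : V, τ v (fun h => W h.1.1)
      else 0

/-- The quantum max-flow: the maximal rank of the linear map over all tensor assignments. -/
noncomputable def QMF [Fintype S] [Fintype T] [Fintype V] [Fintype E] [DecidableEq S]
    [DecidableEq E] (c : E → ℕ) : ℕ :=
  sSup {r | ∃ τ : G.TensorAssignment c, r = (G.beta c τ).rank}

/-- The supremum in `QMF` is a maximum. -/
theorem isGreatest_QMF [Fintype S] [Fintype T] [Fintype V] [Fintype E] [DecidableEq S]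
    [DecidableEq E] (c : E → ℕ) :
    IsGreatest {r | ∃ τ : G.TensorAssignment c, r = (G.beta c τ).rank} (G.QMF c) := by
  have hb : BddAbove {r | ∃ τ : G.TensorAssignment c, r = (G.beta c τ).rank} := by
    refine ⟨Fintype.card ((s : S) → Fin (c (G.inEdge s))), ?_⟩
    rintro r ⟨τ, rfl⟩
    exact Matrix.rank_le_card_width _
  exact ⟨Nat.sSup_mem ⟨_, (fun _ _ => 0), rfl⟩ hb, fun r hr => le_csSup hb hr⟩

/-! ### The quantum min-cut -/

/-- A set `A` of vertices and open ends (standing for the partition into `A` and its complement)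
that contains all inputs and no output. -/
def Separates (_G : OpenGraph S T V E) (A : Set (S ⊕ T ⊕ V)) : Prop :=
  (∀ s : S, Sum.inl s ∈ A) ∧ (∀ t : T, Sum.inr (Sum.inl t) ∉ A)

/-- An edge cut set of the undirected graph: all edges with one end in `A` and the other one in the
complement of `A`, for some separating `A`. -/
def IsEdgeCut (C : Finset E) : Prop :=
  ∃ A : Set (S ⊕ T ⊕ V), G.Separates A ∧
    ∀ e, e ∈ C ↔ ∃ b : Bool, G.att (e, b) ∈ A ∧ G.att (e, !b) ∉ A

/-- The quantum min-cut: the minimum, over all edge cut sets, of the product of the capacities. -/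
noncomputable def QMC (c : E → ℕ) : ℕ :=
  sInf {m | ∃ C : Finset E, G.IsEdgeCut C ∧ m = ∏ e ∈ C, c e}

theorem separates_inputs : G.Separates (Set.range Sum.inl) := by
  constructor <;> simp

/-- The infimum in `QMC` is a minimum. -/
theorem isLeast_QMC [Fintype E] (c : E → ℕ) :
    IsLeast {m | ∃ C : Finset E, G.IsEdgeCut C ∧ m = ∏ e ∈ C, c e} (G.QMC c) := by
  classical
  refine ⟨Nat.sInf_mem ⟨_, Finset.univ.filter (fun e => ∃ b : Bool,
    G.att (e, b) ∈ Set.range Sum.inl ∧ G.att (e, !b) ∉ Set.range Sum.inl),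
    ⟨Set.range Sum.inl, G.separates_inputs, ?_⟩, rfl⟩, fun r hr => Nat.sInf_le hr⟩
  intro e
  rw [Finset.mem_filter]
  exact and_iff_right (Finset.mem_univ e)

/-! ### Directing the graph; classical flows and cuts -/

/-- A direction of the edges: `dir e` is the label of the end at which `e` starts. -/
def Direction (_G : OpenGraph S T V E) : Type _ := E → Bool

variable {G}

namespace Direction

variable (dir : G.Direction)

/-- Where the edge `e` starts. -/
def tail (e : E) : S ⊕ T ⊕ V := G.att (e, dir e)

/-- Where the edge `e` arrives. -/
def head (e : E) : S ⊕ T ⊕ V := G.att (e, !dir e)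

/-- The directed network has the given inputs as sources and the given outputs as sinks: no edge
arrives at an input, and no edge starts at an output. -/
def Compatible : Prop :=
  (∀ (e : E) (s : S), dir.head e ≠ Sum.inl s) ∧
    (∀ (e : E) (t : T), dir.tail e ≠ Sum.inr (Sum.inl t))

/-- An edge cut set of the directed network: all edges that start in `A` and arrive in the
complement of `A`, for some separating `A`. -/
def IsEdgeCut (C : Finset E) : Prop :=
  ∃ A : Set (S ⊕ T ⊕ V), G.Separates A ∧ ∀ e, e ∈ C ↔ dir.tail e ∈ A ∧ dir.head e ∉ A

/-- The classical min-cut of the directed network with real capacities `k`. -/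
noncomputable def MC (k : E → ℝ) : ℝ :=
  sInf {m | ∃ C : Finset E, dir.IsEdgeCut C ∧ m = ∑ e ∈ C, k e}

/-- The infimum in `MC` is a minimum. -/
theorem isLeast_MC [Fintype E] (k : E → ℝ) :
    IsLeast {m | ∃ C : Finset E, dir.IsEdgeCut C ∧ m = ∑ e ∈ C, k e} (dir.MC k) := by
  classical
  have hfin : {m | ∃ C : Finset E, dir.IsEdgeCut C ∧ m = ∑ e ∈ C, k e}.Finite := by
    refine (Set.finite_range (fun C : Finset E => ∑ e ∈ C, k e)).subset ?_
    rintro m ⟨C, -, rfl⟩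
    exact ⟨C, rfl⟩
  refine ⟨Set.Nonempty.csInf_mem ⟨_, Finset.univ.filter (fun e =>
    dir.tail e ∈ Set.range Sum.inl ∧ dir.head e ∉ Set.range Sum.inl),
    ⟨Set.range Sum.inl, G.separates_inputs, ?_⟩, rfl⟩ hfin,
    fun r hr => csInf_le hfin.bddBelow hr⟩
  intro e
  rw [Finset.mem_filter]
  exact and_iff_right (Finset.mem_univ e)

/-- Flows with values in the nonnegative reals: capacity constraint, and conservation at every
vertex that is neither a source nor a sink. -/
structure IsFlow [Fintype E] [DecidableEq S] [DecidableEq T] [DecidableEq V]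
    (k f : E → ℝ) : Prop where
  nonneg : ∀ e, 0 ≤ f e
  le_capacity : ∀ e, f e ≤ k e
  conservation : ∀ v : V,
    ∑ e with dir.head e = Sum.inr (Sum.inr v), f e =
      ∑ e with dir.tail e = Sum.inr (Sum.inr v), f e

/-- The value of a flow: the total flow on the edges that start at a source. -/
noncomputable def value [Fintype S] [Fintype E] [DecidableEq S] [DecidableEq T] [DecidableEq V]
    (f : E → ℝ) : ℝ :=
  ∑ e with ∃ s : S, dir.tail e = Sum.inl s, f e

/-- A flow whose value is the largest among all flows. -/
def IsMaxFlow [Fintype S] [Fintype E] [DecidableEq S] [DecidableEq T] [DecidableEq V]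
    (k f : E → ℝ) : Prop :=
  dir.IsFlow k f ∧ ∀ g : E → ℝ, dir.IsFlow k g → dir.value g ≤ dir.value f

/-- There is a directed loop (a closed directed walk with at least one edge) all of whose edges
carry non-zero flow. -/
def HasFlowLoop (f : E → ℝ) : Prop :=
  ∃ x : S ⊕ T ⊕ V,
    Relation.TransGen (fun y z => ∃ e : E, dir.tail e = y ∧ dir.head e = z ∧ f e ≠ 0) x x

end Direction

end OpenGraph

/-! The upper bound holds for every network. Splitting the contraction along a cut set writes `beta`
as a matrix product through the index set of the cut edges, so its rank is at most the product of
their capacities.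

For the lower bound, write `f e = log_d (n e)`. Flow conservation then says that at each vertex the
incoming edges have as many joint labellings (labels of `e` in `Fin (n e)`) as the outgoing ones, so
a bijection between them exists. Let each tensor be the graph of such a bijection. Since no directed
loop carries flow, labels propagate from the inputs to the whole graph, and the output labels
determine everything back upstream. Hence `beta` contains an identity matrix whose size is the
product of `n e` over the source edges, i.e. `d` to the value of `f`. For `d > 1`, max-flow min-cut
and the assumption on the cuts make this at least `QMC`; for `d < 1` all capacities are 1.

The carrying lemmas are `IsMaxFlow.MC_le_value`, `rank_beta_le_prod` and `Compatible.prod_le_QMF`.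
-/

namespace OpenGraph

/-! ### Max-flow min-cut via the residual network -/

namespace Direction

variable {S T V E : Type*} {G : OpenGraph S T V E} (dir : G.Direction)

/-- One step in the residual network of `f`: along an unsaturated edge, or backwards along an edge
with positive flow. -/
def Residual (k f : E → ℝ) (x y : S ⊕ T ⊕ V) : Prop :=
  ∃ e, (dir.tail e = x ∧ dir.head e = y ∧ f e < k e) ∨
    (dir.head e = x ∧ dir.tail e = y ∧ 0 < f e)

variable [Fintype E] [DecidableEq S] [DecidableEq T] [DecidableEq V]

/-- Inflow minus outflow. -/
def excess (g : E → ℝ) (u : S ⊕ T ⊕ V) : ℝ :=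
  ∑ e, ((if dir.head e = u then g e else 0) - (if dir.tail e = u then g e else 0))

theorem excess_add_mul (g h : E → ℝ) (r : ℝ) (u : S ⊕ T ⊕ V) :
    dir.excess (fun e => g e + r * h e) u = dir.excess g u + r * dir.excess h u := by
  unfold excess
  rw [Finset.mul_sum, ← Finset.sum_add_distrib]
  refine Finset.sum_congr rfl fun e _ => ?_
  split_ifs <;> ring

theorem excess_single [DecidableEq E] (e : E) (u : S ⊕ T ⊕ V) :
    dir.excess (Pi.single e 1) u =
      (if dir.head e = u then 1 else 0) - (if dir.tail e = u then 1 else 0) := by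
  unfold excess
  rw [Finset.sum_eq_single e]
  · simp
  · intro e' _ h
    simp [Pi.single_eq_of_ne h]
  · simp

theorem excess_eq_zero_iff (g : E → ℝ) (v : V) :
    dir.excess g (Sum.inr (Sum.inr v)) = 0 ↔
      ∑ e with dir.head e = Sum.inr (Sum.inr v), g e =
        ∑ e with dir.tail e = Sum.inr (Sum.inr v), g e := by
  rw [excess, Finset.sum_sub_distrib, sub_eq_zero, Finset.sum_filter, Finset.sum_filter]

/-- Every walk in the residual network is the support of a perturbation of the flow. -/
theorem exists_perturbation [DecidableEq E] {k f : E → ℝ} {x y : S ⊕ T ⊕ V}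
    (h : Relation.ReflTransGen (dir.Residual k f) x y) :
    ∃ g : E → ℝ, (∀ e, 0 < g e → f e < k e) ∧ (∀ e, g e < 0 → 0 < f e) ∧
      ∀ u, dir.excess g u = (if y = u then 1 else 0) - (if x = u then 1 else 0) := by
  induction h with
  | refl => exact ⟨0, by simp, by simp, by simp [excess]⟩
  | @tail y z _ hyz ih =>
    obtain ⟨g, hpos, hneg, hex⟩ := ih
    obtain ⟨e, ⟨rfl, rfl, he⟩ | ⟨rfl, rfl, he⟩⟩ := hyz
    · refine ⟨fun e' => g e' + 1 * Pi.single (M := fun _ => ℝ) e 1 e', fun e' h' => ?_,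
        fun e' h' => ?_, fun u => ?_⟩
      · rcases eq_or_ne e' e with rfl | hne
        · exact he
        · exact hpos _ (by simpa [Pi.single_eq_of_ne hne] using h')
      · refine hneg _ (lt_of_le_of_lt ?_ h')
        rcases eq_or_ne e' e with rfl | hne
        · simp
        · simp [Pi.single_eq_of_ne hne]
      · rw [excess_add_mul, hex, excess_single]
        ring
    · refine ⟨fun e' => g e' + (-1) * Pi.single (M := fun _ => ℝ) e 1 e', fun e' h' => ?_,
        fun e' h' => ?_, fun u => ?_⟩
      · refine hpos _ (lt_of_lt_of_le h' ?_)
        rcases eq_or_ne e' e with rfl | hne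
        · simp
        · simp [Pi.single_eq_of_ne hne]
      · rcases eq_or_ne e' e with rfl | hne
        · exact he
        · exact hneg _ (by simpa [Pi.single_eq_of_ne hne] using h')
      · rw [excess_add_mul, hex, excess_single]
        ring

/-- A small multiple of an admissible perturbation respects the capacities. -/
theorem exists_pos_add_mul_mem_Icc {k f g : E → ℝ} (h0 : ∀ e, 0 ≤ f e) (hk : ∀ e, f e ≤ k e)
    (hpos : ∀ e, 0 < g e → f e < k e) (hneg : ∀ e, g e < 0 → 0 < f e) :
    ∃ r : ℝ, 0 < r ∧ ∀ e, 0 ≤ f e + r * g e ∧ f e + r * g e ≤ k e := by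
  have key : ∀ᶠ r in nhdsWithin (0 : ℝ) (Set.Ioi 0),
      ∀ e, 0 ≤ f e + r * g e ∧ f e + r * g e ≤ k e := by
    rw [Filter.eventually_all]
    intro e
    have ht : Filter.Tendsto (fun r : ℝ => f e + r * g e) (nhdsWithin 0 (Set.Ioi 0))
        (nhds (f e)) := by
      have : Filter.Tendsto (fun r : ℝ => f e + r * g e) (nhds 0) (nhds (f e + 0 * g e)) :=
        Continuous.tendsto (by fun_prop) 0
      rw [zero_mul, add_zero] at this
      exact this.mono_left nhdsWithin_le_nhds
    rcases lt_trichotomy (g e) 0 with hg | hg | hg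
    · filter_upwards [self_mem_nhdsWithin, ht.eventually (lt_mem_nhds (hneg e hg))] with r hr h'
      exact ⟨h'.le, by nlinarith [hk e, mul_neg_of_pos_of_neg (Set.mem_Ioi.1 hr) hg]⟩
    · exact Filter.Eventually.of_forall fun r => by simp [hg, h0 e, hk e]
    · filter_upwards [self_mem_nhdsWithin, ht.eventually (gt_mem_nhds (hpos e hg))] with r hr h'
      exact ⟨by nlinarith [h0 e, mul_pos (Set.mem_Ioi.1 hr) hg], h'.le⟩
  have hmem : ∀ᶠ r in nhdsWithin (0 : ℝ) (Set.Ioi 0), r ∈ Set.Ioi (0 : ℝ) := self_mem_nhdsWithin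
  obtain ⟨r, hr, h⟩ := (hmem.and key).exists
  exact ⟨r, hr, h⟩

variable [Fintype S]

variable {dir} in
theorem Compatible.value_eq (hdir : dir.Compatible) (f : E → ℝ) :
    dir.value f = -∑ s : S, dir.excess f (Sum.inl s) := by
  unfold value excess
  rw [Finset.sum_comm, ← Finset.sum_neg_distrib, Finset.sum_filter]
  refine Finset.sum_congr rfl fun e _ => ?_
  have : ∀ s : S, dir.head e ≠ Sum.inl s := hdir.1 e
  simp only [this, if_false, zero_sub, Finset.sum_neg_distrib, neg_neg]
  split_ifs with h
  · obtain ⟨s, hs⟩ := h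
    simp [hs]
  · push Not at h
    simp [h]

-- A residual walk from `s` to `t` would give a perturbation with excess -1 at `s`, +1 at `t` and 0
-- elsewhere; adding a small positive multiple `r` of it keeps a flow and raises the value by `r`.
variable {dir} in
theorem IsMaxFlow.not_reaches_output {k f : E → ℝ} (hf : dir.IsMaxFlow k f)
    (hdir : dir.Compatible) (s : S) (t : T) :
    ¬ Relation.ReflTransGen (dir.Residual k f) (Sum.inl s) (Sum.inr (Sum.inl t)) := by
  classical
  intro h
  obtain ⟨g, hpos, hneg, hex⟩ := dir.exists_perturbation h
  obtain ⟨r, hr, hfg⟩ := exists_pos_add_mul_mem_Icc hf.1.nonneg hf.1.le_capacity hpos hneg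
  have hmax := hf.2 (fun e => f e + r * g e) ⟨fun e => (hfg e).1, fun e => (hfg e).2, fun v => by
    rw [← excess_eq_zero_iff, excess_add_mul, (dir.excess_eq_zero_iff f v).2 (hf.1.conservation v),
      hex]
    simp⟩
  rw [hdir.value_eq, hdir.value_eq] at hmax
  simp only [excess_add_mul, hex, Finset.sum_add_distrib, ← Finset.mul_sum] at hmax
  simp at hmax
  linarith

variable {dir} in
/-- The value of a flow is its net flow across any cut. -/
theorem IsFlow.value_eq_cut [Fintype T] [Fintype V] {k f : E → ℝ} (hf : dir.IsFlow k f)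
    (hdir : dir.Compatible) (A : Set (S ⊕ T ⊕ V)) [DecidablePred (· ∈ A)] (hA : G.Separates A) :
    dir.value f =
      ∑ e, ((if dir.tail e ∈ A then f e else 0) - (if dir.head e ∈ A then f e else 0)) := by
  -- Conservation removes the internal vertices, and `A` contains no output.
  have h1 : ∑ u, (if u ∈ A then dir.excess f u else 0) = ∑ s : S, dir.excess f (Sum.inl s) := by
    rw [Fintype.sum_sum_type, Fintype.sum_sum_type]
    have hv : ∀ v, dir.excess f (Sum.inr (Sum.inr v)) = 0 := fun v =>
      (dir.excess_eq_zero_iff f v).2 (hf.conservation v)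
    simp [hA.1, hA.2, hv]
  rw [hdir.value_eq, ← h1]
  unfold excess
  simp only [← Finset.sum_filter, ← Finset.sum_neg_distrib]
  rw [Finset.sum_comm]
  refine Finset.sum_congr rfl fun e _ => ?_
  simp only [neg_sub, Finset.sum_sub_distrib, Finset.sum_ite_eq, Finset.mem_filter,
    Finset.mem_univ, true_and]

variable {dir} in
/-- The nontrivial half of the max-flow min-cut theorem. -/
theorem IsMaxFlow.MC_le_value [Fintype T] [Fintype V] {k f : E → ℝ} (hf : dir.IsMaxFlow k f)
    (hdir : dir.Compatible) : dir.MC k ≤ dir.value f := by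
  classical
  -- The points reachable from the inputs: edges leaving this set are saturated and edges entering
  -- it carry no flow, so the net flow across it is the capacity of the cut.
  let A : Set (S ⊕ T ⊕ V) :=
    {x | ∃ s : S, Relation.ReflTransGen (dir.Residual k f) (Sum.inl s) x}
  have hA : G.Separates A :=
    ⟨fun s => ⟨s, .refl⟩, fun t ⟨s, h⟩ => hf.not_reaches_output hdir s t h⟩
  refine ((dir.isLeast_MC k).2
    ⟨Finset.univ.filter (fun e => dir.tail e ∈ A ∧ dir.head e ∉ A), ⟨A, hA, by simp⟩, rfl⟩).trans
    (le_of_eq ?_)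
  rw [hf.1.value_eq_cut hdir A hA, Finset.sum_filter]
  refine Finset.sum_congr rfl fun e _ => ?_
  by_cases ht : dir.tail e ∈ A <;> by_cases hh : dir.head e ∈ A
  · simp [ht, hh]
  · have : ¬ f e < k e := fun h' => by
      obtain ⟨s, hs⟩ := ht
      exact hh ⟨s, hs.tail ⟨e, Or.inl ⟨rfl, rfl, h'⟩⟩⟩
    simpa [ht, hh] using (hf.1.le_capacity e).antisymm' (not_lt.1 this)
  · have : ¬ 0 < f e := fun h' => by
      obtain ⟨s, hs⟩ := hh
      exact ht ⟨s, hs.tail ⟨e, Or.inr ⟨rfl, rfl, h'⟩⟩⟩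
    simpa [ht, hh] using (hf.1.nonneg e).antisymm' (not_lt.1 this)
  · simp [ht, hh]

end Direction

end OpenGraph

/-! ### Upper bound: rank across a cut -/

/-- A matrix whose entries are obtained by summing over all labellings of `E` a product of two
factors, which jointly depend only on the labels in `C`, has rank at most the number of labellings
of `C`. -/
theorem Matrix.rank_le_prod_of_dependsOn {E m n : Type*} [Fintype E] [DecidableEq E]
    [Finite m] [Fintype n] {α : E → Type*} [∀ e, Fintype (α e)] [∀ e, Nonempty (α e)]
    (X : n → (∀ e, α e) → ℂ) (Y : m → (∀ e, α e) → ℂ) (a b : Set E) (C : Finset E)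
    (hX : ∀ i, DependsOn (X i) a) (hY : ∀ j, DependsOn (Y j) b) (hC : a ∩ b ⊆ C) :
    (Matrix.of fun j i => ∑ W, Y j W * X i W).rank ≤ ∏ e ∈ C, Fintype.card (α e) := by
  classical
  have := Fintype.ofFinite m
  let e₁ := Equiv.piEquivPiSubtypeProd (· ∈ C) α
  let e₂ := Equiv.piEquivPiSubtypeProd (fun e : {e // e ∉ C} => e.1 ∈ a) (fun e => α e.1)
  let w₀ : ∀ e, α e := fun e => Classical.arbitrary _
  let r₀ := e₂ (e₁ w₀).2
  let P : Matrix m (∀ e : {e // e ∈ C}, α e) ℂ :=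
    .of fun j K => ∑ R, Y j (e₁.symm (K, e₂.symm (r₀.1, R)))
  let Q : Matrix (∀ e : {e // e ∈ C}, α e) n ℂ :=
    .of fun K i => ∑ R, X i (e₁.symm (K, e₂.symm (R, r₀.2)))
  have key : (Matrix.of fun j i => ∑ W, Y j W * X i W) = P * Q := by
    ext j i
    rw [Matrix.mul_apply, Matrix.of_apply, ← e₁.symm.sum_comp, Fintype.sum_prod_type]
    refine Finset.sum_congr rfl fun K _ => ?_
    rw [← e₂.symm.sum_comp, Fintype.sum_prod_type]
    simp only [P, Q, Matrix.of_apply]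
    rw [Finset.sum_mul_sum, Finset.sum_comm]
    refine Finset.sum_congr rfl fun R₂ _ => Finset.sum_congr rfl fun R₁ _ => ?_
    congr 1
    · refine hY j fun e he => ?_
      by_cases h : e ∈ C
      · simp [e₁, h]
      · have ha : e ∉ a := fun ha => h (hC ⟨ha, he⟩)
        simp [e₁, e₂, h, ha]
    · refine hX i fun e he => ?_
      by_cases h : e ∈ C <;> simp [e₁, e₂, h, he]
  rw [key]
  refine (Matrix.rank_mul_le_left P Q).trans (P.rank_le_card_width.trans (le_of_eq ?_))
  rw [Fintype.card_pi]
  exact Finset.prod_coe_sort C fun e => Fintype.card (α e)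

namespace OpenGraph

variable {S T V E : Type*} {G : OpenGraph S T V E}

theorem att_inEnd (s : S) : G.att (G.inEnd s) = Sum.inl s := (G.att_eq_in _ _).2 rfl

theorem att_outEnd (t : T) : G.att (G.outEnd t) = Sum.inr (Sum.inl t) := (G.att_eq_out _ _).2 rfl

variable [Fintype S] [Fintype T] [Fintype V] [Fintype E] [DecidableEq S] [DecidableEq E]

theorem rank_beta_le_prod {c : E → ℕ} (hc : ∀ e, 1 ≤ c e) (τ : G.TensorAssignment c)
    {C : Finset E} (hC : G.IsEdgeCut C) : (G.beta c τ).rank ≤ ∏ e ∈ C, c e := by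
  classical
  obtain ⟨A, hA, hCA⟩ := hC
  have : ∀ e, Nonempty (Fin (c e)) := fun e => ⟨⟨0, hc e⟩⟩
  let X : (∀ s, Fin (c (G.inEdge s))) → (∀ e, Fin (c e)) → ℂ := fun I W =>
    if ∀ s, W (G.inEdge s) = I s then
      ∏ v : V with Sum.inr (Sum.inr v) ∈ A, τ v (fun h => W h.1.1) else 0
  let Y : (∀ t, Fin (c (G.outEdge t))) → (∀ e, Fin (c e)) → ℂ := fun J W =>
    if ∀ t, W (G.outEdge t) = J t then
      ∏ v : V with ¬ Sum.inr (Sum.inr v) ∈ A, τ v (fun h => W h.1.1) else 0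
  have hβ : G.beta c τ = Matrix.of fun J I => ∑ W, Y J W * X I W := by
    ext J I
    refine Finset.sum_congr rfl fun W _ => ?_
    simp only [X, Y]
    rw [← Finset.prod_filter_mul_prod_filter_not Finset.univ
      (fun v : V => (Sum.inr (Sum.inr v) : S ⊕ T ⊕ V) ∈ A)]
    split_ifs <;> first | tauto | ring
  -- Each factor reads only edges with an end on its own side, so the shared edges are cut edges.
  have hle := Matrix.rank_le_prod_of_dependsOn X Y {e | ∃ b, G.att (e, b) ∈ A}
    {e | ∃ b, G.att (e, b) ∉ A} C ?_ ?_ ?_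
  · rw [hβ]
    simpa using hle
  · intro I W W' h
    have hs : ∀ s, W (G.inEdge s) = W' (G.inEdge s) := fun s =>
      h _ ⟨(G.inEnd s).2, by simpa [inEdge, att_inEnd] using hA.1 s⟩
    simp only [X, hs]
    congr 1
    refine Finset.prod_congr rfl fun v hv => ?_
    congr 1
    funext x
    exact h _ ⟨x.1.2, by rw [Prod.mk.eta, x.2]; exact (Finset.mem_filter.1 hv).2⟩
  · intro J W W' h
    have ht : ∀ t, W (G.outEdge t) = W' (G.outEdge t) := fun t =>
      h _ ⟨(G.outEnd t).2, by simpa [outEdge, att_outEnd] using hA.2 t⟩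
    simp only [Y, ht]
    congr 1
    refine Finset.prod_congr rfl fun v hv => ?_
    congr 1
    funext x
    exact h _ ⟨x.1.2, by rw [Prod.mk.eta, x.2]; exact (Finset.mem_filter.1 hv).2⟩
  · rintro e ⟨⟨b, hb⟩, b', hb'⟩
    refine (hCA e).2 ⟨b, hb, ?_⟩
    have : b' = !b := by
      cases b <;> cases b' <;> simp_all
    rwa [← this]

theorem QMF_le_QMC {c : E → ℕ} (hc : ∀ e, 1 ≤ c e) : G.QMF c ≤ G.QMC c := by
  obtain ⟨τ, hτ⟩ := (G.isGreatest_QMF c).1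
  obtain ⟨C, hC, hm⟩ := (G.isLeast_QMC c).1
  rw [hτ, hm]
  exact rank_beta_le_prod hc τ hC

end OpenGraph

/-! ### Lower bound: routing labels along a loop-free flow -/

namespace OpenGraph

variable {S T V E : Type*} {G : OpenGraph S T V E}

namespace Direction

variable (dir : G.Direction)

theorem eq_inEdge_of_tail_eq {e : E} {s : S} (h : dir.tail e = Sum.inl s) : e = G.inEdge s :=
  congrArg Prod.fst ((G.att_eq_in _ _).1 h)

theorem eq_outEdge_of_head_eq {e : E} {t : T} (h : dir.head e = Sum.inr (Sum.inl t)) :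
    e = G.outEdge t :=
  congrArg Prod.fst ((G.att_eq_out _ _).1 h)

/-- Labellings of the edges that arrive at `v`. -/
abbrev InLabels (n : E → ℕ) (v : V) : Type _ :=
  (e : {e // dir.head e = Sum.inr (Sum.inr v)}) → Fin (n e.1)

/-- Labellings of the edges that start at `v`. -/
abbrev OutLabels (n : E → ℕ) (v : V) : Type _ :=
  (e : {e // dir.tail e = Sum.inr (Sum.inr v)}) → Fin (n e.1)

/-- Labellings of the edges that start at an input. -/
abbrev SourceLabels (n : E → ℕ) : Type _ :=
  (e : {e // ∃ s : S, dir.tail e = Sum.inl s}) → Fin (n e.1)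

/-- The part of a labelling on the edges that arrive at `v`. -/
abbrev inPart {n : E → ℕ} (w : (e : E) → Fin (n e)) (v : V) : dir.InLabels n v :=
  fun e => w e.1

/-- The part of a labelling on the edges that start at `v`. -/
abbrev outPart {n : E → ℕ} (w : (e : E) → Fin (n e)) (v : V) : dir.OutLabels n v :=
  fun e => w e.1

/-- The labelling `w` is routed at `v` by the bijection `φ`. -/
def RoutedAt {n : E → ℕ} {v : V} (φ : dir.InLabels n v ≃ dir.OutLabels n v)
    (w : (e : E) → Fin (n e)) : Prop :=
  dir.outPart w v = φ (dir.inPart w v)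

/-- The relation given by the edges with more than one label. -/
def Step (n : E → ℕ) (y z : S ⊕ T ⊕ V) : Prop :=
  ∃ e : E, dir.tail e = y ∧ dir.head e = z ∧ n e ≠ 1

variable {dir} {n : E → ℕ} {φ : ∀ v, dir.InLabels n v ≃ dir.OutLabels n v}

theorem fin_eq_of_eq_one {m : ℕ} (h : m = 1) (a b : Fin m) : a = b := by
  subst h
  exact Subsingleton.elim a b

/-- Induction downstream: the incoming labels at a vertex determine the outgoing ones. Edges with a
single label agree trivially, which is why `Step` may omit them. -/
theorem Compatible.eq_of_eq_on_inputs (hdir : dir.Compatible) (hwf : WellFounded (dir.Step n))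
    {w w' : (e : E) → Fin (n e)} (hw : ∀ v, dir.RoutedAt (φ v) w)
    (hw' : ∀ v, dir.RoutedAt (φ v) w')
    (h : ∀ s, w (G.inEdge s) = w' (G.inEdge s)) : w = w' := by
  suffices ∀ x e, dir.tail e = x → w e = w' e from funext fun e => this _ e rfl
  intro x
  induction x using hwf.induction with
  | h x ih =>
    intro e he
    rcases x with s | t | v
    · rw [dir.eq_inEdge_of_tail_eq he]
      exact h s
    · exact absurd he (hdir.2 e t)
    · have hin : dir.inPart w v = dir.inPart w' v := by
        funext e'
        by_cases h1 : n e'.1 = 1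
        · exact fin_eq_of_eq_one h1 _ _
        · exact ih _ ⟨e'.1, rfl, e'.2, h1⟩ e'.1 rfl
      have := (hw v).trans ((congrArg (φ v) hin).trans (hw' v).symm)
      exact congrFun this ⟨e, he⟩

/-- The mirror induction, upstream, using injectivity of `φ v`. -/
theorem Compatible.eq_of_eq_on_outputs (hdir : dir.Compatible)
    (hwf : WellFounded (Function.swap (dir.Step n)))
    {w w' : (e : E) → Fin (n e)} (hw : ∀ v, dir.RoutedAt (φ v) w)
    (hw' : ∀ v, dir.RoutedAt (φ v) w')
    (h : ∀ t, w (G.outEdge t) = w' (G.outEdge t)) : w = w' := by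
  suffices ∀ x e, dir.head e = x → w e = w' e from funext fun e => this _ e rfl
  intro x
  induction x using hwf.induction with
  | h x ih =>
    intro e he
    rcases x with s | t | v
    · exact absurd he (hdir.1 e s)
    · rw [dir.eq_outEdge_of_head_eq he]
      exact h t
    · have hout : dir.outPart w v = dir.outPart w' v := by
        funext e'
        by_cases h1 : n e'.1 = 1
        · exact fin_eq_of_eq_one h1 _ _
        · exact ih _ ⟨e'.1, e'.2, rfl, h1⟩ e'.1 rfl
      have := (φ v).injective ((hw v).symm.trans (hout.trans (hw' v)))
      exact congrFun this ⟨e, he⟩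

theorem exists_routed (hn : ∀ e, 0 < n e) (hwf : WellFounded (dir.Step n))
    (i : dir.SourceLabels n) :
    ∃ w : (e : E) → Fin (n e), (∀ v, dir.RoutedAt (φ v) w) ∧ ∀ e, w e.1 = i e := by
  classical
  -- Labels are defined by recursion on the tail of the edge. The label 0 at an output is arbitrary,
  -- since routing prescribes only edges that start at internal vertices; on a one-label edge 0 is
  -- forced.
  let F : (x : S ⊕ T ⊕ V) → ((y : S ⊕ T ⊕ V) → dir.Step n y x → (e : E) → dir.tail e = y →
      Fin (n e)) → (e : E) → dir.tail e = x → Fin (n e)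
    | Sum.inl s, _, e, he => i ⟨e, s, he⟩
    | Sum.inr (Sum.inl _), _, e, _ => ⟨0, hn e⟩
    | Sum.inr (Sum.inr v), rec, e, he =>
      φ v (fun e' => if h1 : n e'.1 = 1 then ⟨0, hn _⟩ else
        rec _ ⟨e'.1, rfl, e'.2, h1⟩ e'.1 rfl) ⟨e, he⟩
  let w : (e : E) → Fin (n e) := fun e => hwf.fix F (dir.tail e) e rfl
  have hw : ∀ x e (he : dir.tail e = x), w e = F x (fun y _ => hwf.fix F y) e he := by
    rintro _ e rfl
    exact congrFun (congrFun (hwf.fix_eq F _) e) rfl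
  refine ⟨w, fun v => ?_, fun e => ?_⟩
  · refine funext fun e => ?_
    refine (hw _ e.1 e.2).trans ?_
    refine congrFun (congrArg (φ v) ?_) e
    funext e'
    split_ifs with h1
    · exact fin_eq_of_eq_one h1 _ _
    · rfl
  · obtain ⟨e, s, he⟩ := e
    exact hw _ e he

section Routing

variable (φ) in
/-- The tensor at `v` is the indicator of the routed labellings. -/
noncomputable def routing {c : E → ℕ} (hnc : ∀ e, n e ≤ c e) : G.TensorAssignment c := by
  classical
  exact fun v x => if ∃ w : (e : E) → Fin (n e), dir.RoutedAt (φ v) w ∧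
    ∀ h : G.EndsAt v, x h = Fin.castLE (hnc _) (w h.1.1) then 1 else 0

variable {c : E → ℕ} (hnc : ∀ e, n e ≤ c e)

theorem routing_apply_of_routedAt {w : (e : E) → Fin (n e)} {v : V}
    (hw : dir.RoutedAt (φ v) w) :
    routing φ hnc v (fun h => Fin.castLE (hnc h.1.1) (w h.1.1)) = 1 :=
  if_pos ⟨w, hw, fun _ => rfl⟩

theorem exists_of_routing_ne_zero {v : V} {x : (h : G.EndsAt v) → Fin (c h.1.1)}
    (h : routing φ hnc v x ≠ 0) : ∃ w : (e : E) → Fin (n e), dir.RoutedAt (φ v) w ∧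
      ∀ h : G.EndsAt v, x h = Fin.castLE (hnc _) (w h.1.1) := by
  by_contra h'
  exact h (if_neg h')

/-- A labelling that contributes to the contraction of the routing tensors is routed everywhere. -/
theorem Compatible.exists_routed_of_routing_ne_zero (hdir : dir.Compatible)
    {W : (e : E) → Fin (c e)}
    (hS : ∀ s, (W (G.inEdge s) : ℕ) < n (G.inEdge s))
    (hW : ∀ v, routing φ hnc v (fun h => W h.1.1) ≠ 0) :
    ∃ w : (e : E) → Fin (n e), (∀ v, dir.RoutedAt (φ v) w) ∧
      W = fun e => Fin.castLE (hnc e) (w e) := by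
  choose u hu hWu using fun v => exists_of_routing_ne_zero hnc (hW v)
  have htail : ∀ v e, dir.tail e = Sum.inr (Sum.inr v) → W e = Fin.castLE (hnc e) (u v e) :=
    fun v e he => hWu v ⟨(e, dir e), he⟩
  have hhead : ∀ v e, dir.head e = Sum.inr (Sum.inr v) → W e = Fin.castLE (hnc e) (u v e) :=
    fun v e he => hWu v ⟨(e, !dir e), he⟩
  -- The bound comes from the tail of `e`: the tensor there if it is internal, `hS` if it is an
  -- input.
  have hlt : ∀ e, (W e : ℕ) < n e := by
    intro e
    rcases he : dir.tail e with s | t | v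
    · rw [dir.eq_inEdge_of_tail_eq he]
      exact hS s
    · exact absurd he (hdir.2 e t)
    · rw [htail v e he]
      exact (u v e).2
  let w : (e : E) → Fin (n e) := fun e => ⟨W e, hlt e⟩
  refine ⟨w, fun v => ?_, funext fun e => Fin.ext rfl⟩
  have hin : dir.inPart w v = dir.inPart (u v) v :=
    funext fun e => Fin.ext (congrArg Fin.val (hhead v e.1 e.2) :)
  have hout : dir.outPart w v = dir.outPart (u v) v :=
    funext fun e => Fin.ext (congrArg Fin.val (htail v e.1 e.2) :)
  exact hout.trans ((hu v).trans (congrArg (φ v) hin.symm))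

end Routing

variable [Fintype S] [Fintype T] [Fintype V] [Fintype E] [DecidableEq S] [DecidableEq T]
  [DecidableEq V] [DecidableEq E]

/-- If the labels can be routed without loops, the routing tensors transmit all source labels. -/
theorem Compatible.prod_le_QMF (hdir : dir.Compatible) {c : E → ℕ} (hn : ∀ e, 0 < n e)
    (hnc : ∀ e, n e ≤ c e)
    (hcons : ∀ v : V, ∏ e with dir.head e = Sum.inr (Sum.inr v), n e =
      ∏ e with dir.tail e = Sum.inr (Sum.inr v), n e)
    (hwf : WellFounded (dir.Step n)) (hwf' : WellFounded (Function.swap (dir.Step n))) :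
    ∏ e with ∃ s : S, dir.tail e = Sum.inl s, n e ≤ G.QMF c := by
  classical
  have hφ : ∀ v, Nonempty (dir.InLabels n v ≃ dir.OutLabels n v) := fun v => by
    refine Fintype.card_eq.1 ?_
    simp only [Fintype.card_pi, Fintype.card_fin]
    have h := hcons v
    rw [Finset.prod_subtype _ (fun _ => Finset.mem_filter_univ _),
      Finset.prod_subtype _ (fun _ => Finset.mem_filter_univ _)] at h
    exact h
  let φ v := (hφ v).some
  choose sol hsol hsoli using exists_routed (φ := φ) hn hwf
  let row : dir.SourceLabels n → (t : T) → Fin (c (G.outEdge t)) :=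
    fun i t => Fin.castLE (hnc _) (sol i (G.outEdge t))
  let col : dir.SourceLabels n → (s : S) → Fin (c (G.inEdge s)) :=
    fun i s => Fin.castLE (hnc _) (sol i (G.inEdge s))
  -- A contributing `W` is routed everywhere, so its inputs identify it with `sol i` and its outputs
  -- with `sol j`.
  have hzero : ∀ i j W, (if (∀ s, W (G.inEdge s) = col i s) ∧ (∀ t, W (G.outEdge t) = row j t)
      then ∏ v : V, routing φ hnc v (fun h => W h.1.1) else 0) ≠ 0 →
      j = i ∧ W = fun e => Fin.castLE (hnc e) (sol i e) := by
    intro i j W hne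
    obtain ⟨⟨hS, hT⟩, hW⟩ := ite_ne_right_iff.1 hne
    rw [Finset.prod_ne_zero_iff] at hW
    obtain ⟨w, hw, rfl⟩ := hdir.exists_routed_of_routing_ne_zero hnc (fun s => by
      rw [hS s]
      exact (sol i (G.inEdge s)).2) (fun v => hW v (Finset.mem_univ v))
    have hi : w = sol i := hdir.eq_of_eq_on_inputs hwf hw (hsol i)
      fun s => Fin.castLE_injective _ (hS s)
    have hj : w = sol j := hdir.eq_of_eq_on_outputs hwf' hw (hsol j)
      fun t => Fin.castLE_injective _ (hT t)
    refine ⟨funext fun e => ?_, by rw [hi]⟩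
    rw [← hsoli j, ← hsoli i, ← hj, hi]
  have hone : (G.beta c (routing φ hnc)).submatrix row col = 1 := by
    ext j i
    rw [Matrix.submatrix_apply, beta, Matrix.one_apply]
    split_ifs with hji
    · subst hji
      rw [Finset.sum_eq_single (fun e => Fin.castLE (hnc e) (sol j e))]
      · rw [if_pos ⟨fun _ => rfl, fun _ => rfl⟩]
        exact Finset.prod_eq_one fun v _ => routing_apply_of_routedAt hnc (hsol j v)
      · intro W _ hW
        by_contra hne
        exact hW (hzero _ _ W hne).2
      · simp
    · refine Finset.sum_eq_zero fun W _ => ?_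
      by_contra hne
      exact hji (hzero _ _ W hne).1
  calc ∏ e with ∃ s : S, dir.tail e = Sum.inl s, n e
      = Fintype.card (dir.SourceLabels n) := by
        simp only [Fintype.card_pi, Fintype.card_fin]
        rw [Finset.prod_subtype _ (fun _ => Finset.mem_filter_univ _)]
    _ = ((G.beta c (routing φ hnc)).submatrix row col).rank := by rw [hone, Matrix.rank_one]
    _ ≤ (G.beta c (routing φ hnc)).rank := Matrix.rank_submatrix_le _ _ _
    _ ≤ G.QMF c := (G.isGreatest_QMF c).2 ⟨_, rfl⟩

end Direction

end OpenGraph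

/-! ### From logarithms to integers, and the conclusion -/

theorem Real.sum_logb_natCast {ι : Type*} (s : Finset ι) {n : ι → ℕ} (hn : ∀ i, 1 ≤ n i) (d : ℝ) :
    ∑ i ∈ s, Real.logb d (n i) = Real.logb d ((∏ i ∈ s, n i : ℕ) : ℝ) := by
  rw [Nat.cast_prod, Real.logb_prod]
  exact fun i _ => Nat.cast_ne_zero.2 (Nat.one_le_iff_ne_zero.1 (hn i))

theorem Real.natCast_eq_of_logb_eq {d : ℝ} (hd0 : 0 < d) (hd1 : d ≠ 1) {a b : ℕ} (ha : 1 ≤ a)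
    (hb : 1 ≤ b) (h : Real.logb d a = Real.logb d b) : a = b := by
  have ha' : (a : ℝ) ∈ Set.Ioi 0 := Set.mem_Ioi.2 (Nat.cast_pos.2 ha)
  have hb' : (b : ℝ) ∈ Set.Ioi 0 := Set.mem_Ioi.2 (Nat.cast_pos.2 hb)
  rcases hd1.lt_or_gt with hd | hd
  · exact Nat.cast_injective (Real.logb_injOn_pos_of_base_lt_one hd0 hd ha' hb' h)
  · exact Nat.cast_injective (Real.logb_injOn_pos hd ha' hb' h)

theorem proposition3p8 {S T V E : Type*}
    [Fintype S] [Fintype T] [Fintype V] [Fintype E]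
    [DecidableEq S] [DecidableEq T] [DecidableEq V] [DecidableEq E]
    (G : OpenGraph S T V E) (c : E → ℕ) (hc : ∀ e, 1 ≤ c e)
    (d : ℝ) (hd0 : 0 < d) (hd1 : d ≠ 1) (hlog : ∀ e, 0 ≤ Real.logb d (c e))
    (dir : G.Direction) (hdir : dir.Compatible)
    (hcut : dir.MC (fun e => Real.logb d (c e)) = Real.logb d (G.QMC c))
    (f : E → ℝ) (hf : dir.IsMaxFlow (fun e => Real.logb d (c e)) f)
    (hint : ∀ e, ∃ n : ℕ, 1 ≤ n ∧ f e = Real.logb d n)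
    (hloop : ¬ dir.HasFlowLoop f) :
    G.QMF c = G.QMC c := by
  refine le_antisymm (OpenGraph.QMF_le_QMC hc) ?_
  choose n hn hfn using hint
  have one_le_prod {m : E → ℕ} (hm : ∀ e, 1 ≤ m e) {s : Finset E} : 1 ≤ ∏ e ∈ s, m e :=
    Nat.succ_le_of_lt (Finset.prod_pos fun e _ => Nat.lt_of_succ_le (hm e))
  obtain ⟨C, -, hQ⟩ := (G.isLeast_QMC c).1
  have hQpos : 1 ≤ G.QMC c := by
    rw [hQ]
    exact one_le_prod hc
  -- For base below 1 the logarithm is decreasing, so `0 ≤ logb d (c e)` forces `c e ≤ 1`.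
  have hc1 : d < 1 → ∀ e, c e = 1 := fun hd e => le_antisymm (by
    have h := hlog e
    rw [← Real.logb_one (b := d), Real.logb_le_logb_of_base_lt_one hd0 hd one_pos
      (Nat.cast_pos.2 (hc e))] at h
    exact_mod_cast h) (hc e)
  have hnc : ∀ e, n e ≤ c e := by
    intro e
    have hle := hf.1.le_capacity e
    rcases hd1.lt_or_gt with hd | hd
    · rw [hc1 hd e, Nat.cast_one, Real.logb_one] at hle
      rw [hc1 hd e]
      refine (Real.natCast_eq_of_logb_eq hd0 hd1 (hn e) le_rfl ?_).le
      rw [← hfn, Nat.cast_one, Real.logb_one]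
      exact hle.antisymm (hf.1.nonneg e)
    · rw [hfn, Real.logb_le_logb hd (Nat.cast_pos.2 (hn e)) (Nat.cast_pos.2 (hc e))] at hle
      exact_mod_cast hle
  have hcons : ∀ v : V, ∏ e with dir.head e = Sum.inr (Sum.inr v), n e =
      ∏ e with dir.tail e = Sum.inr (Sum.inr v), n e := by
    intro v
    refine Real.natCast_eq_of_logb_eq hd0 hd1 (one_le_prod hn)
      (one_le_prod hn) ?_
    rw [← Real.sum_logb_natCast _ hn, ← Real.sum_logb_natCast _ hn]
    simpa only [hfn] using hf.1.conservation v
  -- More than one label means non-zero flow, so a cycle of `Step` would be a flow loop; on a finite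
  -- set this gives well-foundedness in both directions.
  have hirr : Std.Irrefl (Relation.TransGen (dir.Step n)) := by
    refine ⟨fun x hx => hloop ⟨x, Relation.TransGen.mono ?_ _ _ hx⟩⟩
    rintro y z ⟨e, hy, hz, h1⟩
    refine ⟨e, hy, hz, fun h0 => h1 (Real.natCast_eq_of_logb_eq hd0 hd1 (hn e) le_rfl ?_)⟩
    rw [← hfn, h0, Nat.cast_one, Real.logb_one]
  have hwf : WellFounded (dir.Step n) :=
    Subrelation.wf Relation.TransGen.single
      (Finite.wellFounded_of_trans_of_irrefl (Relation.TransGen (dir.Step n)))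
  have hwf' : WellFounded (Function.swap (dir.Step n)) :=
    Subrelation.wf (r := Function.swap (Relation.TransGen (dir.Step n)))
      (fun h => Relation.TransGen.single h)
      (Finite.wellFounded_of_trans_of_irrefl (Function.swap (Relation.TransGen (dir.Step n))))
  refine le_trans ?_ (hdir.prod_le_QMF hn hnc hcons hwf hwf')
  rcases hd1.lt_or_gt with hd | hd
  · rw [hQ, Finset.prod_eq_one fun e _ => hc1 hd e]
    exact one_le_prod hn
  · have h := hf.MC_le_value hdir
    rw [hcut, OpenGraph.Direction.value, Finset.sum_congr rfl fun e _ => hfn e,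
      Real.sum_logb_natCast _ hn, Real.logb_le_logb hd (Nat.cast_pos.2 hQpos)
      (Nat.cast_pos.2 (one_le_prod hn))] at h
    exact_mod_cast h
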